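/- **Theorem 3.6.** All graphs are finite, simple and undirected. For a graph $G$ on $n$ vertices with adjacency matrix $A(G)$, let $\pi(G,x)=\operatorname{per}(xI-A(G))$ be its permanental polynomial; $G$ has *purely imaginary per-spectrum* if every complex root of $\pi(G,x)$ has real part $0$ (so the root $0$ is allowed). For integers $l,k\ge 0$, let $\mathcal{R}(K_{1,l}^{(k)},r_2)$ be the rooted tree obtained from $k$ disjoint copies of the star $K_{1,l}$ by adding a new vertex $r_2$, the root, and joining it to the central vertex (the vertex of the part of size $1$) of each copy. The coalescence of two rooted graphs $(G_1,r_1)$ and $(G_2,r_2)$ is the graph obtained from their disjoint union by identifying $r_1$ with $r_2$. Let $r_1$ be a vertex of degree $2$ of the complete bipartite graph $K_{2,3}$, and let $l,k\ge 0$ be integers. Then the coalescence of $(K_{2,3},r_1)$ and $\mathcal{R}(K_{1,l}^{(k)},r_2)$ has purely imaginary per-spectrum if and only if $l+k\ge 4$ and $l\le 2$. -/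

import Mathlib

/-- The permanental polynomial `π(G, x) = per (x I - A(G))` of a finite simple graph, as a
polynomial with complex coefficients. The matrix `Matrix.charmatrix A` is `x I - A`. -/
noncomputable def SimpleGraph.permanentalPoly {V : Type*} [Fintype V] [DecidableEq V]
    (G : SimpleGraph V) [DecidableRel G.Adj] : Polynomial ℂ :=
  (Matrix.charmatrix (G.adjMatrix ℂ)).permanent

/-- The per-spectrum of `G`: the multiset of complex roots of the permanental polynomial,
counted with multiplicity. -/
noncomputable def SimpleGraph.perSpectrum {V : Type*} [Fintype V] [DecidableEq V]
    (G : SimpleGraph V) [DecidableRel G.Adj] : Multiset ℂ :=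
  G.permanentalPoly.roots

/-- `G` has purely imaginary per-spectrum: every element of the per-spectrum lies on the
imaginary axis (zero is considered purely imaginary). -/
def SimpleGraph.HasPurelyImaginaryPerSpectrum {V : Type*} [Fintype V] [DecidableEq V]
    (G : SimpleGraph V) [DecidableRel G.Adj] : Prop :=
  ∀ z ∈ G.perSpectrum, z.re = 0

/-- Adjacency in the coalescence of `(G₁, r₁)` and `(G₂, r₂)`. The vertices are those of `G₁`
together with those of `G₂` other than `r₂`; the vertex `Sum.inl r₁` is the identified root, so
it also receives the edges of `G₂` at `r₂`. -/
def SimpleGraph.coalescenceAdj {V W : Type*} (G₁ : SimpleGraph V) (r₁ : V)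
    (G₂ : SimpleGraph W) (r₂ : W) :
    V ⊕ {w : W // w ≠ r₂} → V ⊕ {w : W // w ≠ r₂} → Prop
  | .inl a, .inl b => G₁.Adj a b
  | .inl a, .inr w => a = r₁ ∧ G₂.Adj r₂ w.1
  | .inr w, .inl a => a = r₁ ∧ G₂.Adj r₂ w.1
  | .inr w, .inr w' => G₂.Adj w.1 w'.1

/-- The coalescence `G₁ · G₂` of the rooted graphs `(G₁, r₁)` and `(G₂, r₂)`, obtained from the
disjoint union by identifying `r₁` with `r₂`. -/
def SimpleGraph.coalescence {V W : Type*} (G₁ : SimpleGraph V) (r₁ : V)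
    (G₂ : SimpleGraph W) (r₂ : W) : SimpleGraph (V ⊕ {w : W // w ≠ r₂}) where
  Adj := SimpleGraph.coalescenceAdj G₁ r₁ G₂ r₂
  symm := ⟨by
    rintro (a | w) (b | w') h
    · exact SimpleGraph.Adj.symm h
    · exact h
    · exact h
    · exact SimpleGraph.Adj.symm h⟩
  loopless := ⟨by
    rintro (a | w) h
    · exact G₁.irrefl h
    · exact G₂.irrefl h⟩

/-- Adjacency in `R(H^{(k)}, r)`: the vertex `none` is the root `r`, and `some (i, w)` is the
vertex `w` of the `i`-th copy of `H`. -/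
def SimpleGraph.rootedPowerAdj {W : Type*} (H : SimpleGraph W) (u : W) (k : ℕ) :
    Option (Fin k × W) → Option (Fin k × W) → Prop
  | none, none => False
  | none, some p => p.2 = u
  | some p, none => p.2 = u
  | some p, some q => p.1 = q.1 ∧ H.Adj p.2 q.2

/-- The graph `R(H^{(k)}, r)`: a new root `r = none` joined to the vertex `u` of each of `k`
disjoint copies of `H`. If `(H, u)` is a rooted tree, this is the rooted tree whose root has
exactly `k` children, with each of the `k` rooted subtrees at the children equal to `(H, u)`. -/
def SimpleGraph.rootedPower {W : Type*} (H : SimpleGraph W) (u : W) (k : ℕ) :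
    SimpleGraph (Option (Fin k × W)) where
  Adj := SimpleGraph.rootedPowerAdj H u k
  symm := ⟨by
    rintro (_ | p) (_ | q) h
    · exact h
    · exact h
    · exact h
    · exact ⟨h.1.symm, SimpleGraph.Adj.symm h.2⟩⟩
  loopless := ⟨by
    rintro (_ | p) h
    · exact h
    · exact H.irrefl h.2⟩

/-- The starlike tree `R(K_{1,l}^{(k)}, r)`, with root `none`: each copy of the star `K_{1,l}` is
rooted at its central vertex `Sum.inl 0`. -/
def SimpleGraph.starlikeTree (l k : ℕ) : SimpleGraph (Option (Fin k × (Fin 1 ⊕ Fin l))) :=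
  (completeBipartiteGraph (Fin 1) (Fin l)).rootedPower (Sum.inl 0) k

/-! Expanding the permanent at the identified vertex (`permanent_attachCopies`) gives `π = per(A)
S^k + k (x²+2)² x^l S^(k-1)`. Here `per(A) = x⁵+6x³+12x` belongs to `K_{2,3}`, `(x²+2)²` to the
4-cycle left when the root is deleted, `S = x^(l+1) + l x^(l-1)` to the star, and `x^l` to the star
without its centre.

For `k > 0` this is `S^(k-1) x^l f(x²)` with `f(y) = (y+l)(y²+6y+12) + k(y+2)²`, so the question is
whether the roots of `f` are real and nonpositive. Sufficiency follows from the signs of `f(-4) =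
4(l+k-4)`, `f(-2) = 4(l-2)` and `f(0) = 12l+4k` (`im_eq_zero_and_re_nonpos_of_cubic_eq_zero`).
Conversely, Newton's inequality for the roots shifted by 2 forces `l ≤ 2`, and the discriminant
excludes the finitely many cases with `l+k ≤ 3` (`bounds_of_real_roots`). For `k = 0` the graph is
`K_{2,3}` itself, and `y²+6y+12` has nonreal roots. -/

namespace Matrix

open Equiv Finset

/-! ### Permanents: row additivity and block matrices. -/

section Permanent

variable {m n R : Type*} [DecidableEq m] [Fintype m] [DecidableEq n] [Fintype n] [CommRing R]

theorem permanent_submatrix_equiv_self (e : n ≃ m) (A : Matrix m m R) :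
    (A.submatrix e e).permanent = A.permanent := by
  refine Fintype.sum_equiv (permCongr e) _ _ fun σ ↦ ?_
  exact Fintype.prod_equiv e _ _ fun i ↦ by simp

theorem permanent_updateRow_add (M : Matrix n n R) (i : n) (u v : n → R) :
    (M.updateRow i (u + v)).permanent =
      (M.updateRow i u).permanent + (M.updateRow i v).permanent := by
  simp only [permanent, ← sum_add_distrib]
  refine sum_congr rfl fun σ _ ↦ ?_
  simp only [← mul_prod_erase _ _ (mem_univ (σ⁻¹ i)), show σ (σ⁻¹ i) = i from σ.apply_symm_apply i,
    updateRow_self, Pi.add_apply, add_mul]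
  have key : ∀ w w' : n → R, ∏ x ∈ univ.erase (σ⁻¹ i), M.updateRow i w (σ x) x =
      ∏ x ∈ univ.erase (σ⁻¹ i), M.updateRow i w' (σ x) x := fun w w' ↦ by
    refine prod_congr rfl fun x hx ↦ ?_
    have hne : σ x ≠ i := fun h ↦ ne_of_mem_erase hx (by simp [← h])
    simp [updateRow_ne hne]
  rw [key (u + v) u, key v u]

theorem permanent_eq_zero_of_row_eq_zero {M : Matrix n n R} (i : n) (h : ∀ j, M i j = 0) :
    M.permanent = 0 :=
  sum_eq_zero fun σ _ ↦ prod_eq_zero (mem_univ (σ⁻¹ i)) (by simp [h])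

/-- Laplace expansion of the permanent along column `0`. -/
theorem permanent_succ_column_zero {n : ℕ} (A : Matrix (Fin (n + 1)) (Fin (n + 1)) R) :
    A.permanent = ∑ i, A i 0 * (A.submatrix i.succAbove Fin.succ).permanent := by
  rw [permanent, univ_perm_fin_succ, ← univ_product_univ]
  simp only [sum_map, toEmbedding_apply, sum_product]
  refine sum_congr rfl fun i _ ↦ Fin.cases ?_ (fun i ↦ ?_) i
  · simp [Fin.prod_univ_succ, permanent, mul_sum]
  · rw [← permanent_permute_cols (Fin.cycleRange i), permanent, mul_sum]
    simp [Fin.prod_univ_succ, Fin.succAbove_cycleRange]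

theorem permanent_fromBlocks_zero₂₁ (A : Matrix m m R) (B : Matrix m n R) (D : Matrix n n R) :
    (fromBlocks A B 0 D).permanent = A.permanent * D.permanent := by
  classical
  simp_rw [permanent]
  convert!
    Eq.symm <|
      sum_subset (M := R)
        (subset_univ ((Perm.sumCongrHom m n).range : Set (Perm (m ⊕ n))).toFinset) ?_
  · simp_rw [sum_mul_sum, ← sum_product', univ_product_univ]
    refine sum_nbij (fun σ ↦ σ.fst.sumCongr σ.snd) ?_ ?_ ?_ ?_
    · intro σ₁₂ _
      exact Set.mem_toFinset.mpr ⟨σ₁₂, rfl⟩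
    · intro σ₁ _ σ₂ _ h
      have h2 : ∀ x, Perm.sumCongr σ₁.fst σ₁.snd x = Perm.sumCongr σ₂.fst σ₂.snd x :=
        DFunLike.congr_fun h
      simp only [Sum.map_inr, Sum.map_inl, Perm.sumCongr_apply, Sum.forall, Sum.inl.injEq,
        Sum.inr.injEq] at h2
      ext x
      · exact h2.left x
      · exact h2.right x
    · intro σ hσ
      rw [mem_coe, Set.mem_toFinset] at hσ
      obtain ⟨σ₁₂, hσ₁₂⟩ := hσ
      use σ₁₂
      rw [← hσ₁₂]
      simp
    · rintro ⟨σ₁, σ₂⟩ _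
      simp [Fintype.prod_sum_type]
  · rintro σ - hσn
    -- A permutation that does not preserve the two blocks picks an entry of the zero block.
    have h1 : ¬∀ x, ∃ y, Sum.inl y = σ (Sum.inl x) := by
      rw [Set.mem_toFinset] at hσn
      simpa only [Set.MapsTo, Set.mem_range, forall_exists_index, forall_apply_eq_imp_iff] using
        mt Perm.mem_sumCongrHom_range_of_perm_mapsTo_inl hσn
    obtain ⟨a, ha⟩ := not_forall.mp h1
    rcases hx : σ (Sum.inl a) with a2 | b
    · exact absurd hx.symm (not_exists.mp ha a2)
    · rw [prod_eq_zero (mem_univ (Sum.inl a))]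
      rw [hx, fromBlocks_apply₂₁, zero_apply]

theorem permanent_fromBlocks_zero₁₂ (A : Matrix m m R) (C : Matrix n m R) (D : Matrix n n R) :
    (fromBlocks A 0 C D).permanent = A.permanent * D.permanent := by
  rw [← permanent_transpose, fromBlocks_transpose, transpose_zero, permanent_fromBlocks_zero₂₁,
    permanent_transpose, permanent_transpose]

/-- The permanent of two blocks coupled by one entry in each off-diagonal block. -/
theorem permanent_fromBlocks_single (A : Matrix m m R) (D : Matrix n n R) (r : m) (u : n)
    (b c : R) :
    (fromBlocks A (single r u b) (single u r c) D).permanent =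
      A.permanent * D.permanent + b * c *
        ((A.updateRow r (Pi.single r 1)).permanent * (D.updateRow u (Pi.single u 1)).permanent) := by
  -- Row `r` and then row `u` are split into their parts in the two blocks. Of the resulting terms,
  -- one is block triangular, one has a zero row in its diagonal block `A`, and one becomes block
  -- diagonal after rows `r` and `u` are swapped, which costs no sign.
  have h₁ : fromBlocks A (single r u b) (single u r c) D =
      (fromBlocks A (single r u b) (single u r c) D).updateRow (.inl r)
        (Sum.elim (A r) (0 : n → R) + Sum.elim (0 : m → R) (Pi.single u b)) := by
    ext (i | i) (j | j) <;> simp [updateRow_apply, single_apply, Pi.single_apply] <;> grind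
  have h₂ : (fromBlocks A (single r u b) (single u r c) D).updateRow (.inl r)
      (Sum.elim (A r) (0 : n → R)) = fromBlocks A 0 (single u r c) D := by
    ext (i | i) (j | j) <;> simp [updateRow_apply, single_apply] <;> grind
  have h₃ : (fromBlocks A (single r u b) (single u r c) D).updateRow (.inl r)
      (Sum.elim (0 : m → R) (Pi.single u b)) =
      (fromBlocks (A.updateRow r 0) (single r u b) (single u r c) D).updateRow (.inr u)
        (Sum.elim (0 : m → R) (D u) + Sum.elim (Pi.single r c) (0 : n → R)) := by
    ext (i | i) (j | j) <;> simp [updateRow_apply, single_apply, Pi.single_apply] <;> grind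
  have h₄ : (fromBlocks (A.updateRow r 0) (single r u b) (single u r c) D).updateRow (.inr u)
        (Sum.elim (0 : m → R) (D u)) = fromBlocks (A.updateRow r 0) (single r u b) 0 D := by
    ext (i | i) (j | j) <;> simp [updateRow_apply, single_apply] <;> grind
  have h₅ : ((fromBlocks (A.updateRow r 0) (single r u b) (single u r c) D).updateRow (.inr u)
        (Sum.elim (Pi.single r c) (0 : n → R))).submatrix (Equiv.swap (Sum.inl r) (Sum.inr u)) id =
      fromBlocks (A.updateRow r (c • Pi.single r 1)) 0 0 (D.updateRow u (b • Pi.single u 1)) := by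
    ext (i | i) j
    · by_cases hi : i = r
      · rcases j with j | j <;> simp [hi, updateRow_apply, Pi.single_apply]
      · rcases j with j | j <;>
          simp [hi, swap_apply_def, updateRow_apply, Ne.symm hi]
    · by_cases hi : i = u
      · rcases j with j | j <;> simp [hi, updateRow_apply, Pi.single_apply, Matrix.single_apply,
          eq_comm]
      · rcases j with j | j <;>
          simp [hi, swap_apply_def, updateRow_apply, Ne.symm hi]
  have h₆ : (A.updateRow r 0).permanent = 0 :=
    permanent_eq_zero_of_row_eq_zero r fun j ↦ by simp
  rw [h₁, permanent_updateRow_add, h₂, h₃, permanent_updateRow_add, h₄,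
    ← permanent_permute_cols (Equiv.swap (Sum.inl r) (Sum.inr u)) (updateRow _ (Sum.inr u) _),
    h₅, permanent_fromBlocks_zero₁₂, permanent_fromBlocks_zero₂₁, permanent_fromBlocks_zero₂₁, h₆, permanent_updateRow_smul,
    permanent_updateRow_smul]
  ring

end Permanent

/-! ### Attaching `k` copies of a block at one index. -/

section AttachCopies

variable {V W R : Type*} [DecidableEq V] [Fintype V] [DecidableEq W] [Fintype W] [CommRing R]

/-- `k` diagonal blocks, all equal to `D`. -/
def diagonalCopies (k : ℕ) (D : Matrix W W R) : Matrix (Fin k × W) (Fin k × W) R :=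
  of fun p q ↦ if p.1 = q.1 then D p.2 q.2 else 0

/-- A block `A` and `k` blocks `D`, where the index `r` of `A` is coupled to the index `u` of
each block `D` by symmetric entries `-1`. -/
def attachCopies (k : ℕ) (A : Matrix V V R) (r : V) (D : Matrix W W R) (u : W) :
    Matrix (V ⊕ Fin k × W) (V ⊕ Fin k × W) R :=
  fromBlocks A (of fun v p ↦ if v = r ∧ p.2 = u then -1 else 0)
    (of fun p v ↦ if v = r ∧ p.2 = u then -1 else 0) (diagonalCopies k D)

/-- Splitting off the first of `k + 1` copies of `W`. -/
def finSuccProdEquiv (k : ℕ) (W : Type*) : Fin k × W ⊕ W ≃ Fin (k + 1) × W where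
  toFun := Sum.elim (fun p ↦ (p.1.succ, p.2)) fun w ↦ (0, w)
  invFun p := Fin.cases (Sum.inr p.2) (fun i ↦ Sum.inl (i, p.2)) p.1
  left_inv := by rintro (_ | _) <;> rfl
  right_inv := by rintro ⟨i, w⟩; cases i using Fin.cases <;> rfl

theorem permanent_diagonalCopies (k : ℕ) (D : Matrix W W R) :
    (diagonalCopies k D).permanent = D.permanent ^ k := by
  induction k with
  | zero => simp [permanent_isEmpty]
  | succ k ih =>
    have h : (diagonalCopies (k + 1) D).submatrix (finSuccProdEquiv k W) (finSuccProdEquiv k W) =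
        fromBlocks (diagonalCopies k D) 0 0 D := by
      ext (i | i) (j | j) <;> simp [diagonalCopies, finSuccProdEquiv, Fin.succ_ne_zero, eq_comm]
    rw [← permanent_submatrix_equiv_self (finSuccProdEquiv k W), h, permanent_fromBlocks_zero₂₁,
      ih, pow_succ]

/-- Replacing row `r` by a unit vector has the effect of deleting the vertex `r` without changing
the index type; the copies then decouple. -/
theorem permanent_attachCopies_updateRow (k : ℕ) (A : Matrix V V R) (r : V) (D : Matrix W W R)
    (u : W) :
    ((attachCopies k A r D u).updateRow (.inl r) (Pi.single (.inl r) 1)).permanent =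
      (A.updateRow r (Pi.single r 1)).permanent * D.permanent ^ k := by
  have h : (attachCopies k A r D u).updateRow (.inl r) (Pi.single (.inl r) 1) =
      fromBlocks (A.updateRow r (Pi.single r 1)) 0
        (of fun p v ↦ if v = r ∧ p.2 = u then -1 else 0) (diagonalCopies k D) := by
    ext (i | i) (j | j) <;> simp [attachCopies, updateRow_apply, Pi.single_apply] <;> grind
  rw [h, permanent_fromBlocks_zero₁₂, permanent_diagonalCopies]

theorem permanent_attachCopies (k : ℕ) (A : Matrix V V R) (r : V) (D : Matrix W W R) (u : W) :
    (attachCopies k A r D u).permanent = A.permanent * D.permanent ^ k +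
      k * ((A.updateRow r (Pi.single r 1)).permanent * (D.updateRow u (Pi.single u 1)).permanent *
        D.permanent ^ (k - 1)) := by
  induction k with
  | zero =>
    have h : attachCopies 0 A r D u = fromBlocks A 0 0 (diagonalCopies 0 D) := by
      ext (i | i) (j | j)
      any_goals simp [attachCopies]
      all_goals first | exact j.1.elim0 | exact i.1.elim0
    rw [h, permanent_fromBlocks_zero₂₁, permanent_diagonalCopies]
    simp
  | succ k ih =>
    let e := (Equiv.sumAssoc V (Fin k × W) W).trans
      (Equiv.sumCongr (Equiv.refl V) (finSuccProdEquiv k W))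
    have h : (attachCopies (k + 1) A r D u).submatrix e e =
        fromBlocks (attachCopies k A r D u) (single (.inl r) u (-1)) (single u (.inl r) (-1)) D := by
      ext ((i | i) | i) ((j | j) | j) <;>
        simp [e, attachCopies, diagonalCopies, finSuccProdEquiv, single_apply, Fin.succ_ne_zero,
          eq_comm, and_comm]
    rw [← permanent_submatrix_equiv_self e, h, permanent_fromBlocks_single, ih,
      permanent_attachCopies_updateRow]
    -- The exponent `k - 1` truncates at `k = 0`, where its coefficient vanishes.
    rcases k with _ | k
    · simp
    · simp only [Nat.add_sub_cancel]
      push_cast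
      ring

end AttachCopies

end Matrix

namespace SimpleGraph

open Matrix Polynomial

/-! ### The coalescence as a block matrix. -/

section Coalescence

variable {V W : Type*} [Fintype V] [DecidableEq V] [Fintype W] [DecidableEq W]

/-- The vertices of `H.rootedPower u k` other than the root. -/
def rootedPowerNonrootEquiv (k : ℕ) (W : Type*) :
    Fin k × W ≃ {w : Option (Fin k × W) // w ≠ none} where
  toFun p := ⟨some p, Option.some_ne_none p⟩
  invFun w := w.1.get (Option.isSome_iff_ne_none.mpr w.2)
  left_inv _ := rfl
  right_inv := by rintro ⟨_ | p, h⟩ <;> simp_all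

theorem permanentalPoly_coalescence_rootedPower (G : SimpleGraph V) [DecidableRel G.Adj] (r : V)
    (H : SimpleGraph W) [DecidableRel H.Adj] (u : W) (k : ℕ)
    [Fintype {w : Option (Fin k × W) // w ≠ none}]
    [DecidableEq (V ⊕ {w : Option (Fin k × W) // w ≠ none})]
    [DecidableRel (G.coalescence r (H.rootedPower u k) none).Adj] :
    (G.coalescence r (H.rootedPower u k) none).permanentalPoly =
      (attachCopies k (charmatrix (G.adjMatrix ℂ)) r (charmatrix (H.adjMatrix ℂ)) u).permanent := by
  let e : V ⊕ Fin k × W ≃ V ⊕ {w : Option (Fin k × W) // w ≠ none} :=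
    Equiv.sumCongr (Equiv.refl V) (rootedPowerNonrootEquiv k W)
  rw [permanentalPoly, ← permanent_submatrix_equiv_self e]
  congr 1
  ext1 i j
  have hii : ∀ a b, (G.coalescence r (H.rootedPower u k) none).Adj (e (.inl a)) (e (.inl b)) ↔
    G.Adj a b := fun _ _ ↦ Iff.rfl
  have hio : ∀ a p, (G.coalescence r (H.rootedPower u k) none).Adj (e (.inl a)) (e (.inr p)) ↔
    a = r ∧ p.2 = u := fun _ _ ↦ Iff.rfl
  have hoi : ∀ a p, (G.coalescence r (H.rootedPower u k) none).Adj (e (.inr p)) (e (.inl a)) ↔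
    a = r ∧ p.2 = u := fun _ _ ↦ Iff.rfl
  have hoo : ∀ p q, (G.coalescence r (H.rootedPower u k) none).Adj (e (.inr p)) (e (.inr q)) ↔
    p.1 = q.1 ∧ H.Adj p.2 q.2 := fun _ _ ↦ Iff.rfl
  rcases i with i | i <;> rcases j with j | j
  · simp [attachCopies, charmatrix_apply, diagonal_apply, hii]
  · simp [attachCopies, hio, apply_ite]
  · simp [attachCopies, hoi, apply_ite]
  · obtain ⟨i, w⟩ := i
    obtain ⟨j, w'⟩ := j
    by_cases hij : i = j <;>
      simp [attachCopies, diagonalCopies, charmatrix_apply, diagonal_apply, hoo, hij]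

end Coalescence

/-! ### The star, itself `l` one-vertex blocks attached to a vertex. -/

section Star

variable (l : ℕ) [DecidableRel (completeBipartiteGraph (Fin 1) (Fin l)).Adj]

theorem charmatrix_star_submatrix :
    (charmatrix ((completeBipartiteGraph (Fin 1) (Fin l)).adjMatrix ℂ)).submatrix
      (Equiv.sumCongr (Equiv.refl _) (Equiv.prodUnique (Fin l) (Fin 1)))
      (Equiv.sumCongr (Equiv.refl _) (Equiv.prodUnique (Fin l) (Fin 1))) =
    attachCopies l (diagonal fun _ : Fin 1 ↦ (X : ℂ[X])) 0
      (diagonal fun _ : Fin 1 ↦ (X : ℂ[X])) 0 := by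
  ext1 i j
  rcases i with i | ⟨i, a⟩ <;> rcases j with j | ⟨j, b⟩ <;>
    simp [attachCopies, diagonalCopies, charmatrix_apply, diagonal_apply,
      Subsingleton.elim _ (0 : Fin 1)]

theorem permanent_charmatrix_star :
    (charmatrix ((completeBipartiteGraph (Fin 1) (Fin l)).adjMatrix ℂ)).permanent =
      X * X ^ l + (l : ℂ[X]) * X ^ (l - 1) := by
  rw [← permanent_submatrix_equiv_self
    (Equiv.sumCongr (Equiv.refl _) (Equiv.prodUnique (Fin l) (Fin 1))), charmatrix_star_submatrix,
    permanent_attachCopies]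
  simp

theorem permanent_charmatrix_star_updateRow :
    ((charmatrix ((completeBipartiteGraph (Fin 1) (Fin l)).adjMatrix ℂ)).updateRow (.inl 0)
      (Pi.single (.inl 0) 1)).permanent = X ^ l := by
  let e := Equiv.sumCongr (Equiv.refl (Fin 1)) (Equiv.prodUnique (Fin l) (Fin 1))
  have h : ((charmatrix ((completeBipartiteGraph (Fin 1) (Fin l)).adjMatrix ℂ)).updateRow (.inl 0)
      (Pi.single (.inl 0) 1)).submatrix e e =
      (attachCopies l (diagonal fun _ : Fin 1 ↦ (X : ℂ[X])) 0
        (diagonal fun _ : Fin 1 ↦ (X : ℂ[X])) 0).updateRow (.inl 0) (Pi.single (.inl 0) 1) := by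
    rw [← charmatrix_star_submatrix, submatrix_updateRow_equiv]
    congr 1
    ext (i | i) <;> simp [e, Pi.single_apply]
  rw [← permanent_submatrix_equiv_self e, h, permanent_attachCopies_updateRow]
  simp

end Star

/-! ### The graph `K_{2,3}` with and without its root. -/

section CompleteBipartite

/-- The matrix `x I - A` for the complete bipartite graph with parts `{0, 1}` and `{2, 3, 4}`. -/
def bipartiteTwoThreeMatrix {R : Type*} [CommRing R] (x : R) : Matrix (Fin 5) (Fin 5) R :=
  !![x, 0, -1, -1, -1; 0, x, -1, -1, -1; -1, -1, x, 0, 0; -1, -1, 0, x, 0; -1, -1, 0, 0, x]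

theorem permanent_bipartiteTwoThreeMatrix {R : Type*} [CommRing R] (x : R) :
    (bipartiteTwoThreeMatrix x).permanent = x ^ 5 + 6 * x ^ 3 + 12 * x := by
  simp [bipartiteTwoThreeMatrix, permanent_succ_column_zero, Fin.sum_univ_succ, Fin.succAbove]
  ring

theorem permanent_bipartiteTwoThreeMatrix_updateRow {R : Type*} [CommRing R] (x : R) (j : Fin 3) :
    ((bipartiteTwoThreeMatrix x).updateRow (Fin.natAdd 2 j)
      (Pi.single (Fin.natAdd 2 j) 1)).permanent = (x ^ 2 + 2) ^ 2 := by
  have h₀ : (bipartiteTwoThreeMatrix x).updateRow 2 (Pi.single 2 1) =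
      !![x, 0, -1, -1, -1; 0, x, -1, -1, -1; 0, 0, 1, 0, 0; -1, -1, 0, x, 0; -1, -1, 0, 0, x] := by
    ext a b
    fin_cases a <;> fin_cases b <;> rfl
  have h₁ : (bipartiteTwoThreeMatrix x).updateRow 3 (Pi.single 3 1) =
      !![x, 0, -1, -1, -1; 0, x, -1, -1, -1; -1, -1, x, 0, 0; 0, 0, 0, 1, 0; -1, -1, 0, 0, x] := by
    ext a b
    fin_cases a <;> fin_cases b <;> rfl
  have h₂ : (bipartiteTwoThreeMatrix x).updateRow 4 (Pi.single 4 1) =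
      !![x, 0, -1, -1, -1; 0, x, -1, -1, -1; -1, -1, x, 0, 0; -1, -1, 0, x, 0; 0, 0, 0, 0, 1] := by
    ext a b
    fin_cases a <;> fin_cases b <;> rfl
  fin_cases j
  · change ((bipartiteTwoThreeMatrix x).updateRow 2 (Pi.single 2 1)).permanent = _
    rw [h₀]
    simp [permanent_succ_column_zero, Fin.sum_univ_succ, Fin.succAbove]
    ring
  · change ((bipartiteTwoThreeMatrix x).updateRow 3 (Pi.single 3 1)).permanent = _
    rw [h₁]
    simp [permanent_succ_column_zero, Fin.sum_univ_succ, Fin.succAbove]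
    ring
  · change ((bipartiteTwoThreeMatrix x).updateRow 4 (Pi.single 4 1)).permanent = _
    rw [h₂]
    simp [permanent_succ_column_zero, Fin.sum_univ_succ, Fin.succAbove]
    ring

variable [DecidableRel (completeBipartiteGraph (Fin 2) (Fin 3)).Adj]

theorem charmatrix_completeBipartiteGraph_two_three_submatrix :
    (charmatrix ((completeBipartiteGraph (Fin 2) (Fin 3)).adjMatrix ℂ)).submatrix
      finSumFinEquiv.symm finSumFinEquiv.symm = bipartiteTwoThreeMatrix X := by
  ext1 i j
  fin_cases i <;> fin_cases j <;>
    simp [bipartiteTwoThreeMatrix, finSumFinEquiv, Fin.addCases]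

theorem permanent_charmatrix_completeBipartiteGraph_two_three :
    (charmatrix ((completeBipartiteGraph (Fin 2) (Fin 3)).adjMatrix ℂ)).permanent =
      X ^ 5 + 6 * X ^ 3 + 12 * X := by
  rw [← permanent_submatrix_equiv_self finSumFinEquiv.symm,
    charmatrix_completeBipartiteGraph_two_three_submatrix, permanent_bipartiteTwoThreeMatrix]

theorem permanent_charmatrix_completeBipartiteGraph_two_three_updateRow (j : Fin 3) :
    ((charmatrix ((completeBipartiteGraph (Fin 2) (Fin 3)).adjMatrix ℂ)).updateRow (.inr j)
      (Pi.single (.inr j) 1)).permanent = (X ^ 2 + 2) ^ 2 := by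
  have h : (fun i ↦ (Pi.single (.inr j) 1 : Fin 2 ⊕ Fin 3 → ℂ[X]) (finSumFinEquiv.symm i)) =
      Pi.single (Fin.natAdd 2 j) 1 := by
    ext1 i
    rw [← finSumFinEquiv_apply_right]
    simp only [Pi.single_apply, Equiv.symm_apply_eq]
  rw [← permanent_submatrix_equiv_self finSumFinEquiv.symm, submatrix_updateRow_equiv,
    charmatrix_completeBipartiteGraph_two_three_submatrix, h, Equiv.symm_symm,
    finSumFinEquiv_apply_right, permanent_bipartiteTwoThreeMatrix_updateRow]

end CompleteBipartite

end SimpleGraph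

/-! ### Roots of the cubic in `y = x²`. -/

namespace SimpleGraph

open Polynomial

/-- With `l ≤ 2` and `4 ≤ l + k`, all complex roots of
`(y + l) (y ^ 2 + 6 y + 12) + k (y + 2) ^ 2` are nonpositive reals. -/
theorem im_eq_zero_and_re_nonpos_of_cubic_eq_zero {l k : ℕ} (hl : l ≤ 2) (hlk : 4 ≤ l + k) {y : ℂ}
    (hy : (y + l) * (y ^ 2 + 6 * y + 12) + k * (y + 2) ^ 2 = 0) : y.im = 0 ∧ y.re ≤ 0 := by
  have hl' : (l : ℝ) ≤ 2 := by exact_mod_cast hl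
  have hlk' : (4 : ℝ) ≤ l + k := by exact_mod_cast hlk
  let f : ℝ → ℝ := fun t ↦ (t + l) * (t ^ 2 + 6 * t + 12) + k * (t + 2) ^ 2
  obtain ⟨a, ⟨ha₁, ha₂⟩, ha⟩ : (0 : ℝ) ∈ f '' Set.Icc (-2) 0 := by
    refine intermediate_value_Icc (by norm_num) (by fun_prop) ⟨?_, ?_⟩
    · simp only [f]; nlinarith
    · simp only [f]; positivity
  simp only [f] at ha
  -- Dividing the cubic by `y - a` leaves `y² + p y + q`.
  set p : ℝ := a + (6 + l + k) with hp
  set q : ℝ := a * p + (12 + 6 * l + 4 * k) with hq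
  have him : y.im = 0 := by
    have hprod : (y - a) * (y ^ 2 + p * y + q) = 0 := by
      have ha' : ((a : ℂ) + l) * (a ^ 2 + 6 * a + 12) + k * (a + 2) ^ 2 = 0 := by
        exact_mod_cast congrArg Complex.ofReal ha
      rw [hq, hp]
      push_cast
      linear_combination hy - ha'
    rcases mul_eq_zero.mp hprod with h | h
    · rw [sub_eq_zero.mp h, Complex.ofReal_im]
    -- Since `a ≥ -2` and the cubic is nonnegative at `-4`, the quadratic factor is nonpositive
    -- there, so its discriminant is nonnegative.
    · have hdisc : 4 * q ≤ p ^ 2 := by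
        have h4 : (-4 - a) * (16 - 4 * p + q) = 4 * (l + k - 4) := by
          rw [hq, hp]; linear_combination -ha
        have : 16 - 4 * p + q ≤ 0 := by
          by_contra! hpos
          nlinarith
        nlinarith [sq_nonneg (p - 8)]
      have hre := congrArg Complex.re h
      have him := congrArg Complex.im h
      simp [pow_two] at hre him
      by_contra hne
      have hp' : p = -2 * y.re := by
        apply mul_right_cancel₀ hne
        linarith
      have := sq_pos_of_ne_zero hne
      nlinarith
  refine ⟨him, ?_⟩
  obtain ⟨t, rfl⟩ : ∃ t : ℝ, y = t := ⟨y.re, Complex.ext rfl (by simpa using him)⟩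
  have hf : (t + l) * (t ^ 2 + 6 * t + 12) + k * (t + 2) ^ 2 = 0 := by exact_mod_cast hy
  by_contra! hpos
  rw [Complex.ofReal_re] at hpos
  have : 0 < (t + l) * (t ^ 2 + 6 * t + 12) + k * (t + 2) ^ 2 := by positivity
  linarith

/-- The inequalities satisfied by the parameters when the cubic
`(y + l) (y ^ 2 + 6 y + 12) + k (y + 2) ^ 2` has the real roots `a`, `b`, `c`. -/
theorem bounds_of_real_roots {l k : ℕ} (hk : k ≠ 0) {a b c : ℝ}
    (h₁ : (6 + l + k : ℝ) = -(a + b + c)) (h₂ : (12 + 6 * l + 4 * k : ℝ) = a * b + a * c + b * c)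
    (h₃ : (12 * l + 4 * k : ℝ) = -(a * b * c)) : 4 ≤ l + k ∧ l ≤ 2 := by
  have hl : l ≤ 2 := by
    by_contra! hl
    have hl' : (3 : ℝ) ≤ l := by exact_mod_cast hl
    have hk' : (0 : ℝ) < k := by exact_mod_cast Nat.pos_of_ne_zero hk
    have hnewton : ∀ p q w : ℝ, 3 * ((p + q + w) * (p * q * w)) ≤ (p * q + p * w + q * w) ^ 2 :=
      fun p q w ↦ by
        nlinarith [sq_nonneg (p * q - p * w), sq_nonneg (p * q - q * w), sq_nonneg (p * w - q * w)]
    -- After the shift, `k` occurs only in the sum of the roots, and the inequality reads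
    -- `3(l+k)(l-2) ≤ l²`, false for `l ≥ 3` and `k ≥ 1`.
    have key := hnewton (a + 2) (b + 2) (c + 2)
    rw [show a + 2 + (b + 2) + (c + 2) = -(l + k : ℝ) by linear_combination h₁,
      show (a + 2) * (b + 2) + (a + 2) * (c + 2) + (b + 2) * (c + 2) = (2 * l : ℝ) by
        linear_combination -h₂ + 4 * h₁,
      show (a + 2) * (b + 2) * (c + 2) = (8 - 4 * l : ℝ) by
        linear_combination h₃ - 2 * h₂ + 4 * h₁] at key
    nlinarith
  refine ⟨?_, hl⟩
  by_contra! hlk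
  have hdisc : 0 ≤ (6 + l + k : ℝ) ^ 2 * (12 + 6 * l + 4 * k) ^ 2 - 4 * (12 + 6 * l + 4 * k) ^ 3
      - 4 * (6 + l + k) ^ 3 * (12 * l + 4 * k) - 27 * (12 * l + 4 * k) ^ 2
      + 18 * (6 + l + k) * (12 + 6 * l + 4 * k) * (12 * l + 4 * k) := by
    rw [h₁, h₂, h₃]
    exact (sq_nonneg ((a - b) * (a - c) * (b - c))).trans_eq (by ring)
  have hk3 : k ≤ 3 := by omega
  -- In each of the six pairs with `k ≥ 1` and `l + k ≤ 3` the discriminant is negative.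
  interval_cases l <;> interval_cases k <;> first | omega | norm_num at hdisc

theorem bounds_of_forall_root_real {l k : ℕ} (hk : k ≠ 0)
    (h : ∀ y : ℂ, (y + l) * (y ^ 2 + 6 * y + 12) + k * (y + 2) ^ 2 = 0 → y.im = 0) :
    4 ≤ l + k ∧ l ≤ 2 := by
  let P : Cubic ℂ := ⟨1, 6 + l + k, 12 + 6 * l + 4 * k, 12 * l + 4 * k⟩
  obtain ⟨x, y, z, hroots⟩ := (Cubic.splits_iff_roots_eq_three (φ := RingHom.id ℂ)
    (P := P) one_ne_zero).mp (IsAlgClosed.splits _)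
  have hreal : ∀ w ∈ (P.map (RingHom.id ℂ)).roots, ∃ t : ℝ, w = t := fun w hw ↦ by
    have hw' := isRoot_of_mem_roots hw
    refine ⟨w.re, Complex.ext rfl (h w ?_)⟩
    simp [IsRoot, Cubic.toPoly, Cubic.map, P] at hw'
    linear_combination hw'
  obtain ⟨a, rfl⟩ := hreal x (by simp [hroots])
  obtain ⟨b, rfl⟩ := hreal y (by simp [hroots])
  obtain ⟨c, rfl⟩ := hreal z (by simp [hroots])
  have h₁ := Cubic.b_eq_three_roots (P := P) one_ne_zero hroots
  have h₂ := Cubic.c_eq_three_roots (P := P) one_ne_zero hroots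
  have h₃ := Cubic.d_eq_three_roots (P := P) one_ne_zero hroots
  simp only [P, RingHom.id_apply, one_mul] at h₁ h₂ h₃
  exact bounds_of_real_roots (a := a) (b := b) (c := c) hk (by exact_mod_cast h₁)
    (by exact_mod_cast h₂) (by exact_mod_cast h₃)

/-! ### The permanental polynomial of the coalescence and the substitution `y = z²`. -/

theorem eval_permanentalPoly_coalescence_starlikeTree (l k : ℕ) (j : Fin 3)
    [DecidableRel (completeBipartiteGraph (Fin 2) (Fin 3)).Adj]
    [DecidableRel (completeBipartiteGraph (Fin 1) (Fin l)).Adj]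
    [Fintype {w : Option (Fin k × (Fin 1 ⊕ Fin l)) // w ≠ none}]
    [DecidableEq ((Fin 2 ⊕ Fin 3) ⊕ {w : Option (Fin k × (Fin 1 ⊕ Fin l)) // w ≠ none})]
    [DecidableRel ((completeBipartiteGraph (Fin 2) (Fin 3)).coalescence (.inr j)
      (starlikeTree l k) none).Adj] (z : ℂ) :
    ((completeBipartiteGraph (Fin 2) (Fin 3)).coalescence (.inr j)
      (starlikeTree l k) none).permanentalPoly.eval z =
      (z ^ 5 + 6 * z ^ 3 + 12 * z) * (z * z ^ l + l * z ^ (l - 1)) ^ k +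
        k * ((z ^ 2 + 2) ^ 2 * z ^ l * (z * z ^ l + l * z ^ (l - 1)) ^ (k - 1)) := by
  unfold starlikeTree at *
  rw [permanentalPoly_coalescence_rootedPower, Matrix.permanent_attachCopies,
    permanent_charmatrix_completeBipartiteGraph_two_three,
    permanent_charmatrix_completeBipartiteGraph_two_three_updateRow,
    permanent_charmatrix_star, permanent_charmatrix_star_updateRow]
  simp

theorem eval_permanentalPoly_factor (l k : ℕ) (z : ℂ) :
    (z ^ 5 + 6 * z ^ 3 + 12 * z) * (z * z ^ l + l * z ^ (l - 1)) ^ (k + 1) +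
        (k + 1 : ℕ) * ((z ^ 2 + 2) ^ 2 * z ^ l * (z * z ^ l + l * z ^ (l - 1)) ^ k) =
      (z * z ^ l + l * z ^ (l - 1)) ^ k * z ^ l *
        ((z ^ 2 + l) * ((z ^ 2) ^ 2 + 6 * z ^ 2 + 12) + (k + 1 : ℕ) * (z ^ 2 + 2) ^ 2) := by
  rcases l with _ | l
  · simp; ring
  · simp only [Nat.add_sub_cancel]; push_cast; ring

theorem re_eq_zero_of_sq_nonpos {z : ℂ} (him : (z ^ 2).im = 0) (hre : (z ^ 2).re ≤ 0) :
    z.re = 0 := by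
  simp [pow_two] at him hre
  by_contra hne
  have h0 : z.im = 0 := by
    apply mul_left_cancel₀ hne
    linarith
  have := sq_pos_of_ne_zero hne
  rw [h0] at hre
  nlinarith

theorem sq_im_eq_zero_of_re_eq_zero {z : ℂ} (h : z.re = 0) : (z ^ 2).im = 0 := by
  simp [pow_two, h]

/-- The degree-two vertices of `K_{2,3}` are those of the part of size three. -/
theorem exists_eq_inr_of_degree_eq_two (r : Fin 2 ⊕ Fin 3)
    [Fintype ((completeBipartiteGraph (Fin 2) (Fin 3)).neighborSet r)]
    (hr : (completeBipartiteGraph (Fin 2) (Fin 3)).degree r = 2) : ∃ j, r = .inr j := by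
  rcases r with i | j
  · have h : (completeBipartiteGraph (Fin 2) (Fin 3)).neighborFinset (.inl i) =
        Finset.univ.map Function.Embedding.inr := by
      ext (x | x) <;> simp
    rw [degree, h] at hr
    simp at hr
  · exact ⟨j, rfl⟩

end SimpleGraph

open Classical in
theorem theorem3p6 (l k : ℕ) (r₁ : Fin 2 ⊕ Fin 3)
    (hr₁ : (completeBipartiteGraph (Fin 2) (Fin 3)).degree r₁ = 2) :
    ((completeBipartiteGraph (Fin 2) (Fin 3)).coalescence r₁
        (SimpleGraph.starlikeTree l k) none).HasPurelyImaginaryPerSpectrum ↔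
      4 ≤ l + k ∧ l ≤ 2 := by
  obtain ⟨j, rfl⟩ := SimpleGraph.exists_eq_inr_of_degree_eq_two r₁ hr₁
  have heval := SimpleGraph.eval_permanentalPoly_coalescence_starlikeTree l k j
  simp only [SimpleGraph.HasPurelyImaginaryPerSpectrum, SimpleGraph.perSpectrum]
  generalize ((completeBipartiteGraph (Fin 2) (Fin 3)).coalescence (Sum.inr j)
    (SimpleGraph.starlikeTree l k) none).permanentalPoly = p at heval ⊢
  -- Needed because `roots` of the zero polynomial is empty; the value at 1 is positive.
  have hp : p ≠ 0 := by
    rintro rfl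
    have h1 := heval 1
    have : (19 * (1 + l) ^ k + k * (9 * (1 + l) ^ (k - 1)) : ℕ) ≠ 0 := by positivity
    refine this ?_
    have h2 : (19 * (1 + l) ^ k + k * (9 * (1 + l) ^ (k - 1)) : ℂ) = 0 := by
      rw [Polynomial.eval_zero] at h1
      norm_num at h1 ⊢
      linear_combination -h1
    exact_mod_cast h2
  simp only [Polynomial.mem_roots hp, Polynomial.IsRoot]
  rcases k with _ | k
  · simp only [heval]
    refine ⟨fun h ↦ ?_, fun h ↦ by omega⟩
    exfalso
    -- `-3 + √3 i` is a root of `y² + 6y + 12`.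
    obtain ⟨z, hz⟩ := IsAlgClosed.exists_pow_nat_eq (-3 + √3 * Complex.I : ℂ) two_pos
    have h3 : ((√3 : ℝ) : ℂ) ^ 2 = 3 := by norm_cast; simp
    have him := SimpleGraph.sq_im_eq_zero_of_re_eq_zero (h z (by
      simp
      linear_combination z * (z ^ 2 + 3 + √3 * Complex.I) * hz + z * Complex.I ^ 2 * h3 +
        3 * z * Complex.I_sq))
    rw [hz] at him
    simp at him
  · simp only [heval, Nat.add_sub_cancel, SimpleGraph.eval_permanentalPoly_factor]
    constructor
    · intro h
      refine SimpleGraph.bounds_of_forall_root_real (Nat.succ_ne_zero k) fun y hy ↦ ?_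
      obtain ⟨z, rfl⟩ := IsAlgClosed.exists_pow_nat_eq y two_pos
      exact SimpleGraph.sq_im_eq_zero_of_re_eq_zero (h z (by rw [hy, mul_zero]))
    · rintro ⟨hlk, hl⟩ z hz
      rcases eq_or_ne z 0 with rfl | hz0
      · simp
      rcases mul_eq_zero.mp hz with h | h
      · have hS : z * z ^ l + l * z ^ (l - 1) = 0 :=
          eq_zero_of_pow_eq_zero ((mul_eq_zero.mp h).resolve_right (pow_ne_zero l hz0))
        have hsq : z ^ 2 = ((-l : ℝ) : ℂ) := by
          -- Multiplying `hS` by `z` removes the truncated exponent `l - 1`; for `l = 0`, `hS`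
          -- already contradicts `z ≠ 0`.
          have : z ^ l * (z ^ 2 + l) = 0 := by
            rcases l with _ | l
            · simp_all
            · simp only [Nat.add_sub_cancel] at hS
              linear_combination z * hS
          have := (mul_eq_zero.mp this).resolve_left (pow_ne_zero l hz0)
          push_cast
          linear_combination this
        apply SimpleGraph.re_eq_zero_of_sq_nonpos <;> rw [hsq]
        · exact Complex.ofReal_im _
        · simp
      · obtain ⟨him, hre⟩ := SimpleGraph.im_eq_zero_and_re_nonpos_of_cubic_eq_zero hl hlk h
        exact SimpleGraph.re_eq_zero_of_sq_nonpos him hre
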